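/- For $n\ge 2$, a history of length $n$ is a permutation $\pi=\pi(1)\cdots\pi(n)$ of the vertices $1,\dots,n$ of the path $P_n$ (with edges $\{i,i+1\}$), where $\pi(i)$ is the vertex switched from $-$ to $+$ at step $i$, all vertices being $-$ at the start. Step $i$ creates a kink if no neighbour of $\pi(i)$ in $P_n$ lies in $\{\pi(1),\dots,\pi(i-1)\}$. For $d\ge 0$ let $F_n^d$ be the set of histories of length $n$ in which exactly $d$ of the steps $i=2,\dots,n$ create a kink (the kink created at step $1$ is not counted). Then the generating function $$G(t,v)=\sum_{n\ge 2}\sum_{d\ge 0}\#F_n^d\,v^d t^n$$ is given, as an identity of formal power series in $t$ and $v$ over $\mathbb{Q}$, by $$G(t,v)=\sum_{j\ge 0}\frac{4t^2\sqrt{1-v}\,\bigl(1-(1+2j)\sqrt{1-v}\,t-t(1-v)\bigr)v^j}{(1+\sqrt{1-v})^{1+2j}\,(1-2jt\sqrt{1-v})^2\,(1-2(j+1)t\sqrt{1-v})^2},$$ where $\sqrt{1-v}$ is the power series in $v$ with constant term $1$ whose square is $1-v$, each quotient is expanded as a formal power series, and for every $n$ and $d$ only finitely many $j$ contribute to the coefficient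 of $t^nv^d$ on the right. -/

import Mathlib

/-- The configuration after `m` steps of the history `π`, where `π i` is the site flipped at
step `i` (steps and sites are numbered from `0`): the set of the sites carrying a `+`. -/
def plusSites {n : ℕ} (π : Equiv.Perm (Fin n)) (m : ℕ) : Set (Fin n) :=
  {w | ∃ k : Fin n, k.val < m ∧ π k = w}

/-- At step `i` of the history `π` a kink is created: no neighbour, in the path with `n` vertices,
of the site flipped at step `i` carries a `+` before that step. -/
def CreatesKink {n : ℕ} (π : Equiv.Perm (Fin n)) (i : Fin n) : Prop :=
  ∀ z : Fin n, (SimpleGraph.pathGraph n).Adj (π i) z → z ∉ plusSites π i.val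

open Classical in
/-- The number of kinks created during the history `π`, not counting the one that the first flip
creates. -/
noncomputable def extraKinks {n : ℕ} (π : Equiv.Perm (Fin n)) : ℕ :=
  (Finset.univ.filter fun i : Fin n => 0 < i.val ∧ CreatesKink π i).card

/-- The set of the histories of length `n` with exactly `d` extra kinks. -/
noncomputable def historySet (n d : ℕ) : Finset (Equiv.Perm (Fin n)) :=
  Finset.univ.filter fun π => extraKinks π = d

/-- Formal power series with rational coefficients in two variables, `t` and `v`. -/
abbrev BivSeries : Type := MvPowerSeries (Fin 2) ℚ

/-- The variable marking the length. -/
noncomputable def tVar : BivSeries := MvPowerSeries.X 0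

/-- The variable marking the number of extra kinks. -/
noncomputable def vVar : BivSeries := MvPowerSeries.X 1

/-- The bivariate generating function of the histories of length at least `2`: the coefficient of
`t ^ n * v ^ d` is the number of histories of length `n` with `d` extra kinks. -/
noncomputable def historyGF : BivSeries :=
  fun e => if 2 ≤ e 0 then ((historySet (e 0) (e 1)).card : ℚ) else 0

/-- The series `√(1 - v)`, given by the binomial series `(1 + x) ^ (1 / 2)` at `x = -v`. -/
noncomputable def sqrtOneSub : BivSeries :=
  (PowerSeries.binomialSeries ℚ (1 / 2 : ℚ)).subst (-vVar)

/-- Formal summability: the family `f` of formal power series has the sum `g` if every coefficient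
receives only finitely many nonzero contributions, and these add up to the coefficient of `g`. -/
def HasFormalSum (f : ℕ → BivSeries) (g : BivSeries) : Prop :=
  ∀ e : Fin 2 →₀ ℕ,
    {j : ℕ | MvPowerSeries.coeff e (f j) ≠ 0}.Finite ∧ ∑ᶠ j : ℕ, MvPowerSeries.coeff e (f j) =
    MvPowerSeries.coeff e g

theorem hasSubst_neg_vVar : PowerSeries.HasSubst (-vVar) :=
  PowerSeries.HasSubst.of_constantCoeff_zero (by simp [vVar])

/-- `√(1 - v)` squares to `1 - v`. -/
theorem sqrtOneSub_sq : sqrtOneSub ^ 2 = 1 - vVar := by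
  have h : PowerSeries.binomialSeries ℚ (1 / 2 : ℚ) ^ 2 = 1 + PowerSeries.X := by
    rw [sq, ← PowerSeries.binomialSeries_add]
    have := PowerSeries.binomialSeries_nat (R := ℚ) (A := ℚ) 1
    norm_num at this ⊢
    exact this
  rw [sqrtOneSub, ← PowerSeries.subst_pow hasSubst_neg_vVar, h,
    ← PowerSeries.coe_substAlgHom hasSubst_neg_vVar, map_add, map_one,
    PowerSeries.substAlgHom_X, sub_eq_add_neg]

/-- `√(1 - v)` is the square root with constant term `1`. -/
theorem constantCoeff_sqrtOneSub : MvPowerSeries.constantCoeff sqrtOneSub = 1 := by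
  have h0 : MvPowerSeries.constantCoeff
      ((PowerSeries.binomialSeries ℚ (1 / 2 : ℚ) - 1).subst (-vVar)) = 0 :=
    PowerSeries.constantCoeff_subst_eq_zero (by simp [vVar]) _ (by simp)
  rw [← PowerSeries.coe_substAlgHom hasSubst_neg_vVar, map_sub, map_one, map_sub, map_one,
    PowerSeries.coe_substAlgHom hasSubst_neg_vVar] at h0
  exact sub_eq_zero.mp h0

/-- The denominators of the explicit series are invertible, so that `⁻¹` is the genuine inverse. -/
theorem denom_mul_inv (j : ℕ) :
    ((1 + sqrtOneSub) ^ (1 + 2 * j) * (1 - 2 * (j : BivSeries) * tVar * sqrtOneSub) ^ 2 *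
        (1 - 2 * ((j : BivSeries) + 1) * tVar * sqrtOneSub) ^ 2) *
      ((1 + sqrtOneSub) ^ (1 + 2 * j) * (1 - 2 * (j : BivSeries) * tVar * sqrtOneSub) ^ 2 *
        (1 - 2 * ((j : BivSeries) + 1) * tVar * sqrtOneSub) ^ 2)⁻¹ = 1 := by
  apply MvPowerSeries.mul_inv_cancel
  simp only [tVar, map_mul, map_pow, map_add, map_sub, map_one,
    constantCoeff_sqrtOneSub, MvPowerSeries.constantCoeff_X]
  norm_num

/-! A step creates a kink exactly when its site is switched before all its neighbours, that is, at a
local minimum of the inverse permutation. So histories are counted by local minima. Inserting a new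
maximum into a permutation of length `n` with `k` local minima keeps `k` in the `2 * k` gaps next to
a peak (the two ends included) and raises it by one in the other `n + 1 - 2 * k`
(`valleyNumber_succ`). Hence `F = G + t` solves `F = t + t * L F`, with `L = growthOp` a first-order
differential operator (`historyGF_growth`).

This equation determines `F`, even modulo each `v ^ N` (`vVar_pow_dvd_of_eq_growthOp`). Write `s =
√(1 - v)`, `w j = v ^ j / (1 + s) ^ (1 + 2 * j)` and `g k = 1 / (1 - 2 * k * t * s)`. The
derivations in `L` cancel on functions of `t * s`, so `L` multiplies `w j * g k` by `1 + (2 * j + 1)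
* s`. The defects of the terms `w j * (g (j + 1) - g j)` therefore telescope: their `N`-th partial
sum solves the equation up to a multiple of `v ^ N` (`partialSum_growth`). The stated terms differ
from these by another telescoping difference, whose lower end removes the extra `t`
(`explicitTerm_eq`). -/

/-! ### Euler operators and coefficients -/

/-- The Euler operator `X i * ∂ / ∂ (X i)`, which multiplies the coefficient of a monomial by the
exponent of `X i` in it. -/
noncomputable def eulerOp (i : Fin 2) : Derivation ℚ BivSeries BivSeries :=
  (MvPowerSeries.X i : BivSeries) • MvPowerSeries.pderiv ℚ i

/-- The coefficient of `t ^ n * v ^ d`. -/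
noncomputable def bcoeff (n d : ℕ) : BivSeries →ₗ[ℚ] ℚ :=
  MvPowerSeries.coeff (Finsupp.single 0 n + Finsupp.single 1 d)

theorem exponent_eq (e : Fin 2 →₀ ℕ) : e = Finsupp.single 0 (e 0) + Finsupp.single 1 (e 1) := by
  ext i
  fin_cases i <;> simp

theorem coeff_eulerOp (i : Fin 2) (e : Fin 2 →₀ ℕ) (f : BivSeries) :
    MvPowerSeries.coeff e (eulerOp i f) = e i * MvPowerSeries.coeff e f := by
  change MvPowerSeries.coeff e (MvPowerSeries.X i * MvPowerSeries.pderiv ℚ i f) = _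
  by_cases h : e i = 0
  · rw [h, Nat.cast_zero, zero_mul]
    exact MvPowerSeries.X_dvd_iff.mp (dvd_mul_right _ _) e h
  · obtain ⟨e', rfl⟩ : ∃ e', e = Finsupp.single i 1 + e' :=
      ⟨e - Finsupp.single i 1, (add_tsub_cancel_of_le (by
        rw [Finsupp.single_le_iff]; omega)).symm⟩
    rw [MvPowerSeries.X_def, MvPowerSeries.coeff_add_monomial_mul, MvPowerSeries.coeff_pderiv,
      add_comm e']
    simp
    ring

theorem bcoeff_eulerOp_zero (n d : ℕ) (f : BivSeries) :
    bcoeff n d (eulerOp 0 f) = n * bcoeff n d f := by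
  rw [bcoeff, coeff_eulerOp]; simp

theorem bcoeff_eulerOp_one (n d : ℕ) (f : BivSeries) :
    bcoeff n d (eulerOp 1 f) = d * bcoeff n d f := by
  rw [bcoeff, coeff_eulerOp]; simp

theorem bcoeff_succ_tVar_mul (n d : ℕ) (f : BivSeries) :
    bcoeff (n + 1) d (tVar * f) = bcoeff n d f := by
  have : (Finsupp.single 0 (n + 1) + Finsupp.single 1 d : Fin 2 →₀ ℕ)
      = Finsupp.single 0 1 + (Finsupp.single 0 n + Finsupp.single 1 d) := by
    rw [add_comm n 1, Finsupp.single_add, add_assoc]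
  rw [bcoeff, this, tVar, MvPowerSeries.X_def, MvPowerSeries.coeff_add_monomial_mul, one_mul]
  rfl

theorem bcoeff_zero_tVar_mul (d : ℕ) (f : BivSeries) : bcoeff 0 d (tVar * f) = 0 :=
  MvPowerSeries.X_dvd_iff.mp (dvd_mul_right _ _) _ (by simp)

theorem bcoeff_succ_vVar_mul (n d : ℕ) (f : BivSeries) :
    bcoeff n (d + 1) (vVar * f) = bcoeff n d f := by
  have : (Finsupp.single 0 n + Finsupp.single 1 (d + 1) : Fin 2 →₀ ℕ)
      = Finsupp.single 1 1 + (Finsupp.single 0 n + Finsupp.single 1 d) := by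
    rw [add_comm d 1, Finsupp.single_add, add_left_comm]
  rw [bcoeff, this, vVar, MvPowerSeries.X_def, MvPowerSeries.coeff_add_monomial_mul, one_mul]
  rfl

theorem bcoeff_zero_vVar_mul (n : ℕ) (f : BivSeries) : bcoeff n 0 (vVar * f) = 0 :=
  MvPowerSeries.X_dvd_iff.mp (dvd_mul_right _ _) _ (by simp)

theorem vVar_pow_dvd_iff (N : ℕ) (f : BivSeries) :
    vVar ^ N ∣ f ↔ ∀ n d, d < N → bcoeff n d f = 0 := by
  rw [vVar, MvPowerSeries.X_pow_dvd_iff]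
  refine ⟨fun h n d hd => h _ (by simpa using hd), fun h e he => ?_⟩
  rw [exponent_eq e]
  exact h _ _ he

theorem bivSeries_ext {f g : BivSeries} (h : ∀ n d, bcoeff n d f = bcoeff n d g) : f = g := by
  ext e
  rw [exponent_eq e]
  exact h _ _

/-! ### The growth equation and its uniqueness -/

/-- The linear operator that adds one site to the histories counted by a generating function. -/
noncomputable def growthOp (f : BivSeries) : BivSeries :=
  2 * (1 - vVar) * eulerOp 1 f + (2 - vVar) * f + vVar * eulerOp 0 f

theorem growthOp_sub (f g : BivSeries) : growthOp (f - g) = growthOp f - growthOp g := by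
  simp only [growthOp, map_sub]; ring

theorem growthOp_sum (s : Finset ℕ) (f : ℕ → BivSeries) :
    growthOp (∑ i ∈ s, f i) = ∑ i ∈ s, growthOp (f i) := by
  simp only [growthOp, map_sum, Finset.mul_sum, Finset.sum_add_distrib]

theorem growthOp_eq (f : BivSeries) : growthOp f =
    (2 : ℚ) • eulerOp 1 f + (2 : ℚ) • f + vVar * (eulerOp 0 f - (2 : ℚ) • eulerOp 1 f - f) := by
  simp only [growthOp, ofNat_smul_eq_nsmul, two_nsmul]
  ring

theorem bcoeff_growthOp_zero (n : ℕ) (f : BivSeries) :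
    bcoeff n 0 (growthOp f) = 2 * bcoeff n 0 f := by
  simp [growthOp_eq, bcoeff_zero_vVar_mul, bcoeff_eulerOp_one]

theorem bcoeff_growthOp_succ (n d : ℕ) (f : BivSeries) :
    bcoeff n (d + 1) (growthOp f) =
      (2 * d + 4) * bcoeff n (d + 1) f + (n - 2 * d - 1) * bcoeff n d f := by
  simp [growthOp_eq, bcoeff_succ_vVar_mul, bcoeff_eulerOp_one, bcoeff_eulerOp_zero]
  ring

/-- The factor `tVar` ties each power of `t` to the previous one, and `growthOp` never lowers the
`v`-degree, so induction on the `t`-degree works. Applied to a difference of approximate solutions,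
this is uniqueness modulo `v ^ N`. -/
theorem vVar_pow_dvd_of_eq_growthOp {N : ℕ} {E R : BivSeries} (hR : vVar ^ N ∣ R)
    (hE : E = tVar * growthOp E + R) : vVar ^ N ∣ E := by
  rw [vVar_pow_dvd_iff] at hR ⊢
  intro n
  induction n with
  | zero =>
    intro d hd
    rw [hE, map_add, bcoeff_zero_tVar_mul, hR _ _ hd, add_zero]
  | succ n ih =>
    intro d hd
    rw [hE, map_add, bcoeff_succ_tVar_mul, hR _ _ hd, add_zero]
    cases d with
    | zero => rw [bcoeff_growthOp_zero, ih _ hd, mul_zero]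
    | succ d => rw [bcoeff_growthOp_succ, ih _ hd, ih d (by omega), mul_zero, mul_zero, add_zero]

/-! ### Telescoping approximate solutions -/

theorem eulerOp_tVar_zero : eulerOp 0 tVar = tVar := by
  change MvPowerSeries.X 0 * MvPowerSeries.pderiv ℚ 0 tVar = _
  simp [tVar, MvPowerSeries.pderiv_X_self]

theorem eulerOp_tVar_one : eulerOp 1 tVar = 0 := by
  change MvPowerSeries.X 1 * MvPowerSeries.pderiv ℚ 1 tVar = _
  rw [tVar, MvPowerSeries.pderiv_X_of_ne (by decide), mul_zero]

theorem eulerOp_vVar_zero : eulerOp 0 vVar = 0 := by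
  change MvPowerSeries.X 0 * MvPowerSeries.pderiv ℚ 0 vVar = _
  rw [vVar, MvPowerSeries.pderiv_X_of_ne (by decide), mul_zero]

theorem eulerOp_vVar_one : eulerOp 1 vVar = vVar := by
  change MvPowerSeries.X 1 * MvPowerSeries.pderiv ℚ 1 vVar = _
  simp [vVar, MvPowerSeries.pderiv_X_self]

theorem vVar_eq : vVar = 1 - sqrtOneSub ^ 2 := by
  rw [sqrtOneSub_sq]; ring

theorem two_mul_sqrtOneSub_mul_eulerOp (i : Fin 2) :
    2 * sqrtOneSub * eulerOp i sqrtOneSub = -eulerOp i vVar := by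
  have h := congrArg (eulerOp i) sqrtOneSub_sq
  rw [pow_two, Derivation.leibniz, map_sub, Derivation.map_one_eq_zero] at h
  simp only [smul_eq_mul] at h
  linear_combination h

theorem eulerOp_sqrtOneSub_zero : eulerOp 0 sqrtOneSub = 0 := by
  have h := two_mul_sqrtOneSub_mul_eulerOp 0
  rw [eulerOp_vVar_zero, neg_zero] at h
  refine (mul_eq_zero.mp h).resolve_left fun h2 => ?_
  have h3 := congrArg MvPowerSeries.constantCoeff h2
  rw [two_mul, map_add, constantCoeff_sqrtOneSub] at h3
  norm_num at h3

theorem mul_eulerOp_sqrtOneSub_one :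
    2 * (1 - vVar) * eulerOp 1 sqrtOneSub = -vVar * sqrtOneSub := by
  have h := two_mul_sqrtOneSub_mul_eulerOp 1
  rw [eulerOp_vVar_one] at h
  linear_combination sqrtOneSub * h - 2 * eulerOp 1 sqrtOneSub * sqrtOneSub_sq

/-- The inverse of `1 + √(1 - v)`. -/
noncomputable def invOneAddSqrt : BivSeries := (1 + sqrtOneSub)⁻¹

/-- The geometric series `1 / (1 - 2 k t √(1 - v))`. -/
noncomputable def geomSeries (k : ℕ) : BivSeries := (1 - 2 * (k : BivSeries) * tVar * sqrtOneSub)⁻¹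

/-- The weights `v ^ j / (1 + √(1 - v)) ^ (1 + 2 * j)`. -/
noncomputable def weightSeries (j : ℕ) : BivSeries := vVar ^ j * invOneAddSqrt ^ (1 + 2 * j)

theorem one_add_sqrt_mul_inv : (1 + sqrtOneSub) * invOneAddSqrt = 1 :=
  MvPowerSeries.mul_inv_cancel _ (by
    rw [map_add, map_one, constantCoeff_sqrtOneSub]; norm_num)

theorem geomSeries_mul (k : ℕ) :
    (1 - 2 * (k : BivSeries) * tVar * sqrtOneSub) * geomSeries k = 1 :=
  MvPowerSeries.mul_inv_cancel _ (by simp [tVar])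

theorem vVar_mul_invOneAddSqrt : vVar * invOneAddSqrt = 1 - sqrtOneSub := by
  linear_combination (1 - sqrtOneSub) * one_add_sqrt_mul_inv + invOneAddSqrt * vVar_eq

theorem weightSeries_zero : weightSeries 0 = invOneAddSqrt := by simp [weightSeries]

theorem weightSeries_succ (j : ℕ) :
    weightSeries (j + 1) = weightSeries j * (vVar * invOneAddSqrt ^ 2) := by
  simp only [weightSeries]; ring

/-- Since `v = (1 - s) * (1 + s)`, consecutive weights have ratio `(1 - s) / (1 + s)`; this is what
makes both sums telescope. -/
theorem one_add_mul_weightSeries_succ (j : ℕ) :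
    (1 + sqrtOneSub) * weightSeries (j + 1) = (1 - sqrtOneSub) * weightSeries j := by
  rw [weightSeries_succ]
  linear_combination weightSeries j * vVar * invOneAddSqrt * one_add_sqrt_mul_inv +
    weightSeries j * vVar_mul_invOneAddSqrt

theorem eulerOp_natCast (i : Fin 2) (k : ℕ) : eulerOp i (k : BivSeries) = 0 :=
  Derivation.map_natCast _ _

theorem mul_eulerOp_invOneAddSqrt :
    2 * (1 - vVar) * eulerOp 1 invOneAddSqrt = vVar * sqrtOneSub * invOneAddSqrt ^ 2 := by
  have h := congrArg (eulerOp 1) one_add_sqrt_mul_inv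
  rw [Derivation.leibniz, map_add, Derivation.map_one_eq_zero] at h
  simp only [smul_eq_mul] at h
  linear_combination 2 * (1 - vVar) * invOneAddSqrt * h -
    2 * (1 - vVar) * eulerOp 1 invOneAddSqrt * one_add_sqrt_mul_inv -
    invOneAddSqrt ^ 2 * mul_eulerOp_sqrtOneSub_one

theorem mul_eulerOp_weightSeries (j : ℕ) :
    2 * (1 - vVar) * eulerOp 1 (weightSeries j) =
      sqrtOneSub * (2 * (j : BivSeries) + 1 - sqrtOneSub) * weightSeries j := by
  induction j with
  | zero =>
    rw [weightSeries_zero, mul_eulerOp_invOneAddSqrt]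
    push_cast
    linear_combination sqrtOneSub * invOneAddSqrt * vVar_mul_invOneAddSqrt
  | succ j ih =>
    rw [weightSeries_succ, Derivation.leibniz, Derivation.leibniz, pow_two, Derivation.leibniz,
      eulerOp_vVar_one]
    simp only [smul_eq_mul]
    push_cast
    linear_combination vVar * invOneAddSqrt ^ 2 * ih +
      2 * weightSeries j * vVar * invOneAddSqrt * mul_eulerOp_invOneAddSqrt +
      2 * weightSeries j * sqrtOneSub * vVar * invOneAddSqrt ^ 2 * vVar_mul_invOneAddSqrt -
      2 * weightSeries j * vVar * invOneAddSqrt ^ 2 * vVar_eq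

theorem eulerOp_weightSeries_zero (j : ℕ) : eulerOp 0 (weightSeries j) = 0 := by
  have hy : eulerOp 0 invOneAddSqrt = 0 := by
    have h := congrArg (eulerOp 0) one_add_sqrt_mul_inv
    rw [Derivation.leibniz, map_add, Derivation.map_one_eq_zero, eulerOp_sqrtOneSub_zero] at h
    simp only [smul_eq_mul] at h
    linear_combination invOneAddSqrt * h - eulerOp 0 invOneAddSqrt * one_add_sqrt_mul_inv
  rw [weightSeries, Derivation.leibniz, Derivation.leibniz_pow, Derivation.leibniz_pow,
    eulerOp_vVar_zero, hy]
  simp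

theorem eulerOp_geomSeries (i : Fin 2) (k : ℕ) :
    eulerOp i (geomSeries k) =
      geomSeries k ^ 2 * (2 * k * eulerOp i (tVar * sqrtOneSub)) := by
  have h := congrArg (eulerOp i) (geomSeries_mul k)
  have hk : eulerOp i (2 * (k : BivSeries)) = 0 := by
    have h2 : 2 * (k : BivSeries) = ((2 * k : ℕ) : BivSeries) := by push_cast; rfl
    rw [h2, eulerOp_natCast]
  rw [mul_assoc (2 * (k : BivSeries))] at h
  rw [Derivation.leibniz, map_sub, Derivation.leibniz _ (2 * (k : BivSeries)), hk,
    Derivation.map_one_eq_zero] at h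
  simp only [smul_eq_mul] at h
  linear_combination geomSeries k * h - eulerOp i (geomSeries k) * geomSeries_mul k

/-- The series depends on `t * s` alone, and this derivation annihilates `t * s`. -/
theorem geomSeries_euler_cancel (k : ℕ) :
    2 * (1 - vVar) * eulerOp 1 (geomSeries k) + vVar * eulerOp 0 (geomSeries k) = 0 := by
  rw [eulerOp_geomSeries, eulerOp_geomSeries, Derivation.leibniz, Derivation.leibniz,
    eulerOp_tVar_zero, eulerOp_tVar_one, eulerOp_sqrtOneSub_zero]
  simp only [smul_eq_mul]
  linear_combination geomSeries k ^ 2 * 2 * k * tVar * mul_eulerOp_sqrtOneSub_one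

/-- The factor `1 - t * (1 + (2 * j + 1) * s)` equals the denominator of `geomSeries (j + 1)` minus
`t * (1 - s)`, and that of `geomSeries j` minus `t * (1 + s)`. The constants cancel in the
difference. -/
theorem sub_growthOp_weight_mul_geom (j : ℕ) :
    weightSeries j * (geomSeries (j + 1) - geomSeries j) -
        tVar * growthOp (weightSeries j * (geomSeries (j + 1) - geomSeries j)) =
      tVar * ((1 + sqrtOneSub) * weightSeries j * geomSeries j -
        (1 + sqrtOneSub) * weightSeries (j + 1) * geomSeries (j + 1)) := by
  rw [growthOp, Derivation.leibniz, Derivation.leibniz, map_sub, map_sub,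
    eulerOp_weightSeries_zero]
  simp only [smul_eq_mul]
  have h1 := geomSeries_mul (j + 1)
  push_cast at h1
  linear_combination
    -tVar * weightSeries j * (geomSeries_euler_cancel (j + 1)) +
    tVar * weightSeries j * (geomSeries_euler_cancel j) -
    tVar * (geomSeries (j + 1) - geomSeries j) * mul_eulerOp_weightSeries j +
    weightSeries j * h1 - weightSeries j * geomSeries_mul j +
    tVar * geomSeries (j + 1) * one_add_mul_weightSeries_succ j +
    tVar * weightSeries j * (geomSeries (j + 1) - geomSeries j) * vVar_eq

theorem geomSeries_zero : geomSeries 0 = 1 := by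
  have := geomSeries_mul 0
  simpa using this

theorem partialSum_growth (N : ℕ) :
    (∑ j ∈ Finset.range N, weightSeries j * (geomSeries (j + 1) - geomSeries j)) -
        tVar * growthOp
          (∑ j ∈ Finset.range N, weightSeries j * (geomSeries (j + 1) - geomSeries j)) =
      tVar - tVar * ((1 + sqrtOneSub) * weightSeries N * geomSeries N) := by
  rw [growthOp_sum, Finset.mul_sum, ← Finset.sum_sub_distrib,
    Finset.sum_congr rfl fun j _ => sub_growthOp_weight_mul_geom j, ← Finset.mul_sum,
    Finset.sum_range_sub' fun j => (1 + sqrtOneSub) * weightSeries j * geomSeries j,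
    weightSeries_zero, geomSeries_zero, one_add_sqrt_mul_inv]
  ring

theorem vVar_pow_dvd_weightSeries (N : ℕ) : vVar ^ N ∣ weightSeries N := dvd_mul_right _ _

/-! ### The explicit series -/

/-- The general term of the explicit series. -/
noncomputable def explicitTerm (j : ℕ) : BivSeries :=
  4 * tVar ^ 2 * sqrtOneSub *
      (1 - (1 + 2 * (j : BivSeries)) * sqrtOneSub * tVar - tVar * (1 - vVar)) * vVar ^ j *
    ((1 + sqrtOneSub) ^ (1 + 2 * j) * (1 - 2 * (j : BivSeries) * tVar * sqrtOneSub) ^ 2 *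
      (1 - 2 * ((j : BivSeries) + 1) * tVar * sqrtOneSub) ^ 2)⁻¹

theorem explicitTerm_eq (j : ℕ) : explicitTerm j =
    weightSeries j * (geomSeries (j + 1) - geomSeries j) +
      tVar * ((1 + sqrtOneSub) * weightSeries (j + 1) * geomSeries (j + 1) ^ 2 -
        (1 + sqrtOneSub) * weightSeries j * geomSeries j ^ 2) := by
  have h1 := geomSeries_mul (j + 1)
  push_cast at h1
  have h0 := geomSeries_mul j
  have hy : (1 + sqrtOneSub) ^ (1 + 2 * j) * invOneAddSqrt ^ (1 + 2 * j) = 1 := by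
    rw [← mul_pow, one_add_sqrt_mul_inv, one_pow]
  have hinv : ((1 + sqrtOneSub) ^ (1 + 2 * j) * (1 - 2 * (j : BivSeries) * tVar * sqrtOneSub) ^ 2 *
      (1 - 2 * ((j : BivSeries) + 1) * tVar * sqrtOneSub) ^ 2)⁻¹ =
      invOneAddSqrt ^ (1 + 2 * j) * geomSeries j ^ 2 * geomSeries (j + 1) ^ 2 := by
    refine (left_inv_eq_right_inv (a := _) ?_ (denom_mul_inv j)).symm
    calc _ = ((1 + sqrtOneSub) ^ (1 + 2 * j) * invOneAddSqrt ^ (1 + 2 * j)) *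
          ((1 - 2 * (j : BivSeries) * tVar * sqrtOneSub) * geomSeries j) ^ 2 *
          ((1 - 2 * ((j : BivSeries) + 1) * tVar * sqrtOneSub) * geomSeries (j + 1)) ^ 2 := by ring
      _ = 1 := by rw [hy, h0, h1]; ring
  -- In the numerator, `1 - (1 + 2 * j) * s * t` is the mean of the two linear denominators, hence
  -- comes from the sum of the geometric series; `t * (1 - v) = t * s ^ 2` comes from their squared
  -- difference.
  have hd : geomSeries (j + 1) - geomSeries j =
      2 * tVar * sqrtOneSub * geomSeries j * geomSeries (j + 1) := by
    linear_combination geomSeries j * h1 - geomSeries (j + 1) * h0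
  have hs : geomSeries (j + 1) + geomSeries j =
      2 * geomSeries j * geomSeries (j + 1) *
        (1 - (1 + 2 * (j : BivSeries)) * sqrtOneSub * tVar) := by
    linear_combination -geomSeries j * h1 - geomSeries (j + 1) * h0
  have hw := one_add_mul_weightSeries_succ j
  rw [explicitTerm, hinv]
  calc _ = weightSeries j * (tVar * (2 * tVar * sqrtOneSub * geomSeries j * geomSeries (j + 1)) *
          (2 * geomSeries j * geomSeries (j + 1) *
            (1 - (1 + 2 * (j : BivSeries)) * sqrtOneSub * tVar)) -
        tVar * sqrtOneSub * (2 * tVar * sqrtOneSub * geomSeries j * geomSeries (j + 1)) ^ 2) := by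
        rw [weightSeries, vVar_eq]; ring
    _ = weightSeries j * (tVar * (geomSeries (j + 1) - geomSeries j) *
          (geomSeries (j + 1) + geomSeries j) -
        tVar * sqrtOneSub * (geomSeries (j + 1) - geomSeries j) ^ 2) := by rw [hd, hs]
    _ = _ := by
      linear_combination -tVar * geomSeries (j + 1) ^ 2 * hw - weightSeries j * hd

theorem sum_explicitTerm (N : ℕ) : ∑ j ∈ Finset.range N, explicitTerm j =
    (∑ j ∈ Finset.range N, weightSeries j * (geomSeries (j + 1) - geomSeries j)) - tVar +
      tVar * ((1 + sqrtOneSub) * weightSeries N * geomSeries N ^ 2) := by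
  rw [Finset.sum_congr rfl fun j _ => explicitTerm_eq j, Finset.sum_add_distrib, ← Finset.mul_sum,
    Finset.sum_range_sub fun j => (1 + sqrtOneSub) * weightSeries j * geomSeries j ^ 2,
    weightSeries_zero, geomSeries_zero, one_pow, one_add_sqrt_mul_inv]
  ring

theorem vVar_pow_dvd_sub_sum_explicitTerm {g : BivSeries}
    (hg : g + tVar = tVar + tVar * growthOp (g + tVar)) (N : ℕ) :
    vVar ^ N ∣ g - ∑ j ∈ Finset.range N, explicitTerm j := by
  have hK := partialSum_growth N
  rw [sum_explicitTerm]
  set K := ∑ j ∈ Finset.range N, weightSeries j * (geomSeries (j + 1) - geomSeries j)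
  have hW : ∀ r : BivSeries, vVar ^ N ∣ tVar * ((1 + sqrtOneSub) * weightSeries N * r) := fun r =>
    (((vVar_pow_dvd_weightSeries N).mul_left _).mul_right _).mul_left _
  have h1 : vVar ^ N ∣ g + tVar - K :=
    vVar_pow_dvd_of_eq_growthOp (hW (geomSeries N)) (by
      rw [growthOp_sub]; linear_combination hg - hK)
  convert dvd_sub h1 (hW (geomSeries N ^ 2)) using 1
  ring

theorem vVar_pow_dvd_explicitTerm (j : ℕ) : vVar ^ j ∣ explicitTerm j :=
  (dvd_mul_left _ _).mul_right _

theorem hasFormalSum_explicitTerm {g : BivSeries}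
    (hg : g + tVar = tVar + tVar * growthOp (g + tVar)) : HasFormalSum explicitTerm g := by
  intro e
  rw [exponent_eq e]
  set n := e 0
  set d := e 1
  change {j | bcoeff n d (explicitTerm j) ≠ 0}.Finite ∧
    ∑ᶠ j, bcoeff n d (explicitTerm j) = bcoeff n d g
  -- Divisibility of the term by `v ^ j` leaves only `j ≤ d`.
  have hsub : {j | bcoeff n d (explicitTerm j) ≠ 0} ⊆ Finset.range (d + 1) := by
    intro j hj
    by_contra hlt
    rw [Finset.coe_range, Set.mem_Iio, not_lt] at hlt
    exact hj ((vVar_pow_dvd_iff _ _).mp (vVar_pow_dvd_explicitTerm j) n d (by omega))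
  refine ⟨(Finset.finite_toSet _).subset hsub, ?_⟩
  rw [finsum_eq_sum_of_support_subset _ hsub, ← map_sum]
  have := (vVar_pow_dvd_iff _ _).mp (vVar_pow_dvd_sub_sum_explicitTerm hg (d + 1)) n d (by omega)
  rw [map_sub, sub_eq_zero] at this
  exact this.symm

/-! ### Rises of 0-1 words under insertion -/

/-- The number of indices `i < n` with `a i = 0` and `a (i + 1) = 1`, for `0`-`1` sequences `a`. -/
def riseCount (a : ℕ → ℤ) (n : ℕ) : ℤ := ∑ i ∈ Finset.range n, (1 - a i) * a (i + 1)

/-- The increase of `riseCount` when the letter at position `p` is replaced by `1, 0`, the first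
and the last letter being treated differently. -/
def riseGain (a : ℕ → ℤ) (n p : ℕ) : ℤ :=
  if p = 0 ∨ p = n then 0 else a p * a (p + 1) + (1 - a p) * (1 - a (p - 1))

theorem riseCount_insert {a b : ℕ → ℤ} {n p : ℕ} (h0 : a 0 = 0) (hn : a n = 1) (hp : p ≤ n)
    (hlt : ∀ i < p, b i = a i) (hgt : ∀ i, p < i → i ≤ n → b (i + 1) = a i)
    (hb : b p = if p = 0 then 0 else 1) (hb' : b (p + 1) = if p = n then 1 else 0) :
    riseCount b (n + 1) = riseCount a n + riseGain a n p := by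
  unfold riseCount riseGain
  have hn0 : n ≠ 0 := by rintro rfl; simp [h0] at hn
  rcases Nat.eq_zero_or_pos p with rfl | hp0
  · rw [Finset.sum_range_succ']
    obtain ⟨m, rfl⟩ := Nat.exists_eq_succ_of_ne_zero hn0
    rw [Finset.sum_range_succ', Finset.sum_range_succ' _ m]
    have : ∀ i ∈ Finset.range m, (1 - b (i + 1 + 1)) * b (i + 1 + 1 + 1) =
        (1 - a (i + 1)) * a (i + 1 + 1) := by
      intro i hi
      rw [Finset.mem_range] at hi
      rw [hgt (i + 1) (by omega) (by omega), hgt (i + 1 + 1) (by omega) (by omega)]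
    rw [Finset.sum_congr rfl this]
    have h2 := hgt 1 (by omega) (by omega)
    simp at hb hb' h2 ⊢
    rw [hb, hb', h0, h2]; ring
  · obtain ⟨q, rfl⟩ : ∃ q, p = q + 1 := ⟨p - 1, by omega⟩
    have hfst : ∀ i ∈ Finset.range q, (1 - b i) * b (i + 1) = (1 - a i) * a (i + 1) := by
      intro i hi
      rw [Finset.mem_range] at hi
      rw [hlt i (by omega), hlt (i + 1) (by omega)]
    rcases hp.eq_or_lt with rfl | hpn
    · rw [Finset.sum_range_succ, Finset.sum_range_succ, Finset.sum_range_succ _ q,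
        Finset.sum_congr rfl hfst, hlt q (by omega), hn]
      simp at hb hb' ⊢
      rw [hb, hb']; ring
    · obtain ⟨m, rfl⟩ : ∃ m, n = q + (2 + m) := ⟨n - q - 2, by omega⟩
      rw [show q + (2 + m) + 1 = q + (3 + m) by omega, Finset.sum_range_add _ q (3 + m),
        Finset.sum_range_add _ q (2 + m),
        Finset.sum_range_add _ 3 m, Finset.sum_range_add _ 2 m, Finset.sum_congr rfl hfst]
      have hsnd : ∀ i ∈ Finset.range m, (1 - b (q + (3 + i))) * b (q + (3 + i) + 1) =
          (1 - a (q + (2 + i))) * a (q + (2 + i) + 1) := by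
        intro i hi
        rw [Finset.mem_range] at hi
        rw [← hgt (q + (2 + i)) (by omega) (by omega),
          ← hgt (q + (2 + i) + 1) (by omega) (by omega),
          show q + (3 + i) = q + (2 + i) + 1 by omega]
      rw [Finset.sum_congr rfl hsnd]
      have h2 := hgt (q + 2) (by omega) (by omega)
      rw [if_neg (by omega)] at hb hb'
      rw [if_neg (by omega)]
      simp only [Finset.sum_range_succ, Finset.sum_range_zero, add_zero, zero_add,
        Nat.add_sub_cancel]
      simp only [add_assoc, Nat.reduceAdd] at *
      rw [hlt q (by omega), hb, hb', h2]; ring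

/-- For a 0-1 word, the gain vanishes at the two ends and on both letters of each factor `1, 0`.
From first letter `0` to last letter `1` there is one such factor fewer than rises, so with `k`
rises `2 * k` positions gain nothing. -/
theorem sum_riseGain {a : ℕ → ℤ} {n : ℕ} (h0 : a 0 = 0) (hn : a n = 1) :
    ∑ p ∈ Finset.range (n + 1), riseGain a n p = n + 1 - 2 * riseCount a n := by
  have hn0 : n ≠ 0 := by rintro rfl; simp [h0] at hn
  obtain ⟨m, rfl⟩ := Nat.exists_eq_succ_of_ne_zero hn0
  -- With `x, y, z` consecutive, `y * z = z - (1 - y) * z` and `(1 - y) * (1 - x) = 1 - x - (1 - x)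
  -- * y`: two rise terms, and `z - x` telescopes.
  have key : ∀ k, ∑ p ∈ Finset.range k, (a (p + 1) * a (p + 1 + 1) +
      (1 - a (p + 1)) * (1 - a p)) = k - riseCount a k - riseCount a (k + 1) + a (k + 1) +
        a k := by
    intro k
    induction k with
    | zero => simp [riseCount, h0]
    | succ k ih =>
      rw [Finset.sum_range_succ, ih]
      simp only [riseCount, Finset.sum_range_succ]
      push_cast
      ring
  rw [Finset.sum_range_succ, Finset.sum_range_succ']
  have : ∀ i ∈ Finset.range m, riseGain a (m + 1) (i + 1) =
      a (i + 1) * a (i + 1 + 1) + (1 - a (i + 1)) * (1 - a i) := by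
    intro i hi
    rw [Finset.mem_range] at hi
    rw [riseGain, if_neg (by omega), Nat.add_sub_cancel]
  rw [Finset.sum_congr rfl this, key]
  simp only [Nat.succ_eq_add_one] at hn ⊢
  simp [riseGain, riseCount, Finset.sum_range_succ, hn]
  ring

theorem riseGain_eq_zero_or_one {a : ℕ → ℤ} (ha : ∀ i, a i = 0 ∨ a i = 1) (n p : ℕ) :
    riseGain a n p = 0 ∨ riseGain a n p = 1 := by
  unfold riseGain
  split_ifs
  · exact Or.inl rfl
  · rcases ha p with h | h <;> rcases ha (p + 1) with h' | h' <;> rcases ha (p - 1) with h'' | h'' <;>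
      simp [h, h', h'']

theorem sum_indicator_riseGain {a : ℕ → ℤ} {n : ℕ} (ha : ∀ i, a i = 0 ∨ a i = 1) (h0 : a 0 = 0)
    (hn : a n = 1) (k : ℤ) :
    ∑ p ∈ Finset.range (n + 1), (if riseCount a n + riseGain a n p = k + 1 then (1 : ℤ) else 0) =
      2 * (k + 1) * (if riseCount a n = k + 1 then 1 else 0) +
        (n + 1 - 2 * k) * (if riseCount a n = k then 1 else 0) := by
  -- A gain in `{0, 1}` makes the indicator affine in the gain, so only the total gain matters.
  have h : ∀ p, (if riseCount a n + riseGain a n p = k + 1 then (1 : ℤ) else 0) =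
      (1 - riseGain a n p) * (if riseCount a n = k + 1 then 1 else 0) +
        riseGain a n p * (if riseCount a n = k then 1 else 0) := by
    intro p
    rcases riseGain_eq_zero_or_one ha n p with h | h <;> simp [h]
  rw [Finset.sum_congr rfl fun p _ => h p, Finset.sum_add_distrib, ← Finset.sum_mul,
    ← Finset.sum_mul, Finset.sum_sub_distrib, sum_riseGain h0 hn]
  by_cases h1 : riseCount a n = k + 1
  · rw [h1]; simp
  · by_cases h2 : riseCount a n = k
    · rw [h2]; simp
    · simp [h1, h2]

/-! ### Local minima under insertion of a maximum -/

/-- The letters `σ 0, …, σ (n - 1)` at the positions `1, …, n`, all others being `n`. -/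
def paddedWord {n : ℕ} (σ : Equiv.Perm (Fin n)) (i : ℕ) : ℕ :=
  if h : 0 < i ∧ i ≤ n then σ ⟨i - 1, by omega⟩ else n

/-- The indicator of the ascents of the padded word. -/
def ascent {n : ℕ} (σ : Equiv.Perm (Fin n)) (i : ℕ) : ℤ :=
  if i ≠ 0 ∧ (i = n ∨ paddedWord σ i < paddedWord σ (i + 1)) then 1 else 0

theorem paddedWord_succ {n : ℕ} (σ : Equiv.Perm (Fin n)) (i : Fin n) :
    paddedWord σ (i + 1) = σ i := by
  rw [paddedWord, dif_pos (by omega)]; rfl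

theorem ascent_zero_or_one {n : ℕ} (σ : Equiv.Perm (Fin n)) (i : ℕ) :
    ascent σ i = 0 ∨ ascent σ i = 1 := by
  unfold ascent; split_ifs <;> simp

theorem ascent_zero {n : ℕ} (σ : Equiv.Perm (Fin n)) : ascent σ 0 = 0 := by simp [ascent]

theorem ascent_last {n : ℕ} (hn : n ≠ 0) (σ : Equiv.Perm (Fin n)) : ascent σ n = 1 := by
  simp [ascent, hn]

/-- The number of local minima of a permutation. -/
def valleyCount {n : ℕ} (σ : Equiv.Perm (Fin n)) : ℤ := riseCount (ascent σ) n

/-- Insert a new maximum at position `p` into the permutation `σ`. -/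
def insertMax {n : ℕ} (p : Fin (n + 1)) (σ : Equiv.Perm (Fin n)) : Equiv.Perm (Fin (n + 1)) :=
  ((finSuccEquiv' p).trans (Equiv.optionCongr σ)).trans (finSuccEquiv' (Fin.last n)).symm

theorem insertMax_self {n : ℕ} (p : Fin (n + 1)) (σ : Equiv.Perm (Fin n)) :
    insertMax p σ p = Fin.last n := by simp [insertMax]

theorem insertMax_succAbove {n : ℕ} (p : Fin (n + 1)) (σ : Equiv.Perm (Fin n)) (i : Fin n) :
    insertMax p σ (p.succAbove i) = (σ i).castSucc := by simp [insertMax]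

theorem insertMax_bijective (n : ℕ) : Function.Bijective
    fun x : Fin (n + 1) × Equiv.Perm (Fin n) => insertMax x.1 x.2 := by
  rw [Fintype.bijective_iff_injective_and_card]
  constructor
  · rintro ⟨p, σ⟩ ⟨q, τ⟩ h
    simp only at h
    obtain rfl : p = q := by
      have h1 := insertMax_self p σ
      rw [h, ← insertMax_self q τ] at h1
      exact (insertMax q τ).injective h1
    refine Prod.ext rfl (Equiv.ext fun i => ?_)
    have h1 := insertMax_succAbove p σ i
    rw [h, insertMax_succAbove] at h1
    exact (Fin.castSucc_injective _ h1).symm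
  · simp [Fintype.card_perm, Nat.factorial_succ]

theorem paddedWord_insertMax_lt {n : ℕ} (p : Fin (n + 1)) (σ : Equiv.Perm (Fin n)) {i : ℕ}
    (hi : 0 < i) (hip : i ≤ p) : paddedWord (insertMax p σ) i = paddedWord σ i := by
  obtain ⟨j, rfl⟩ : ∃ j, i = j + 1 := ⟨i - 1, by omega⟩
  have hj : j < n := by omega
  have h1 := paddedWord_succ (insertMax p σ) (p.succAbove ⟨j, hj⟩)
  rw [insertMax_succAbove, Fin.succAbove_of_castSucc_lt _ _ (by
    rw [Fin.lt_def]; simpa using hip)] at h1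
  exact h1.trans (paddedWord_succ σ ⟨j, hj⟩).symm

theorem paddedWord_insertMax_gt {n : ℕ} (p : Fin (n + 1)) (σ : Equiv.Perm (Fin n)) {i : ℕ}
    (hi : p.val < i) (hin : i ≤ n) : paddedWord (insertMax p σ) (i + 1) = paddedWord σ i := by
  obtain ⟨j, rfl⟩ : ∃ j, i = j + 1 := ⟨i - 1, by omega⟩
  have hj : j < n := by omega
  have h1 := paddedWord_succ (insertMax p σ) (p.succAbove ⟨j, hj⟩)
  rw [insertMax_succAbove, Fin.succAbove_of_le_castSucc _ _ (by
    rw [Fin.le_def]; simpa using Nat.lt_succ_iff.mp hi)] at h1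
  exact h1.trans (paddedWord_succ σ ⟨j, hj⟩).symm

theorem paddedWord_insertMax_self {n : ℕ} (p : Fin (n + 1)) (σ : Equiv.Perm (Fin n)) :
    paddedWord (insertMax p σ) (p + 1) = n := by
  rw [paddedWord_succ, insertMax_self, Fin.val_last]

theorem paddedWord_lt {n : ℕ} (σ : Equiv.Perm (Fin n)) {i : ℕ} (h0 : 0 < i) (hi : i ≤ n) :
    paddedWord σ i < n := by
  rw [paddedWord, dif_pos ⟨h0, hi⟩]; exact Fin.is_lt _

theorem ascent_congr {m n : ℕ} {σ : Equiv.Perm (Fin m)} {τ : Equiv.Perm (Fin n)} {i j : ℕ}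
    (h : (i ≠ 0 ∧ (i = m ∨ paddedWord σ i < paddedWord σ (i + 1))) ↔
      (j ≠ 0 ∧ (j = n ∨ paddedWord τ j < paddedWord τ (j + 1)))) : ascent σ i = ascent τ j := by
  simp only [ascent, h]

/-- The new maximum turns the comparison at its gap into an ascent followed by a descent. At the
ends the padding is larger still, giving two descents on the left and two ascents on the right. -/
theorem valleyCount_insertMax {n : ℕ} (hn : n ≠ 0) (p : Fin (n + 1)) (σ : Equiv.Perm (Fin n)) :
    valleyCount (insertMax p σ) = valleyCount σ + riseGain (ascent σ) n p := by
  have hp := p.is_le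
  refine riseCount_insert (ascent_zero σ) (ascent_last hn σ) hp ?_ ?_ ?_ ?_
  · intro i hi
    apply ascent_congr
    rcases Nat.eq_zero_or_pos i with rfl | h0
    · simp
    · rw [paddedWord_insertMax_lt p σ h0 hi.le, paddedWord_insertMax_lt p σ (by omega) hi]
      have h1 : i ≠ n + 1 := by omega
      have h2 : i ≠ n := by omega
      simp [h1, h2]
  · intro i hi hin
    apply ascent_congr
    rcases hin.eq_or_lt with rfl | hlt
    · simp [hn]
    · rw [paddedWord_insertMax_gt p σ hi hin, paddedWord_insertMax_gt p σ (by omega) hlt]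
      have h1 : i ≠ 0 := by omega
      simp [h1]
  · by_cases h0 : (p : ℕ) = 0
    · rw [if_pos h0, h0, ascent_zero]
    · rw [if_neg h0, ascent, if_pos]
      refine ⟨h0, Or.inr ?_⟩
      rw [paddedWord_insertMax_self, paddedWord_insertMax_lt p σ (by omega) le_rfl]
      exact paddedWord_lt σ (by omega) hp
  · by_cases h0 : (p : ℕ) = n
    · rw [if_pos h0, h0, ascent_last (by omega)]
    · rw [if_neg h0, ascent, if_neg]
      rintro ⟨-, h | h⟩
      · omega
      · rw [paddedWord_insertMax_self, paddedWord_insertMax_gt p σ (by omega) (by omega)] at h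
        exact absurd h (paddedWord_lt σ (by omega) (by omega)).le.not_gt

/-- The number of permutations with `k` local minima. -/
def valleyNumber (n : ℕ) (k : ℤ) : ℤ :=
  ∑ σ : Equiv.Perm (Fin n), if valleyCount σ = k then 1 else 0

theorem valleyNumber_succ {n : ℕ} (hn : n ≠ 0) (k : ℤ) :
    valleyNumber (n + 1) (k + 1) =
      2 * (k + 1) * valleyNumber n (k + 1) + (n + 1 - 2 * k) * valleyNumber n k := by
  unfold valleyNumber
  rw [← (insertMax_bijective n).sum_comp fun τ => if valleyCount τ = k + 1 then (1 : ℤ) else 0,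
    Fintype.sum_prod_type_right, Finset.mul_sum, Finset.mul_sum, ← Finset.sum_add_distrib]
  refine Finset.sum_congr rfl fun σ _ => ?_
  rw [valleyCount, ← sum_indicator_riseGain (ascent_zero_or_one σ) (ascent_zero σ)
    (ascent_last hn σ) k, ← Fin.sum_univ_eq_sum_range
      (fun p => if riseCount (ascent σ) n + riseGain (ascent σ) n p = k + 1 then (1 : ℤ) else 0)]
  refine Finset.sum_congr rfl fun p _ => ?_
  rw [valleyCount_insertMax hn]
  rfl

/-! ### Kinks as local minima of the inverse -/

theorem createsKink_iff {n : ℕ} (π : Equiv.Perm (Fin n)) (w : Fin n) :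
    CreatesKink π (π⁻¹ w) ↔
      ∀ z : Fin n, (w.val + 1 = z.val ∨ z.val + 1 = w.val) → π⁻¹ w < π⁻¹ z := by
  have hw : π (π⁻¹ w) = w := π.apply_symm_apply w
  simp only [CreatesKink, plusSites, SimpleGraph.pathGraph_adj, hw,
    Set.mem_ofPred_eq, not_exists, not_and]
  refine forall_congr' fun z => imp_congr_right fun hz => ⟨fun h => ?_, fun h k hk hkz => ?_⟩
  · by_contra hlt
    have hne : π⁻¹ z ≠ π⁻¹ w := fun he => by
      have := (π⁻¹).injective he
      subst this
      omega
    exact h (π⁻¹ z) (Fin.lt_def.mp (lt_of_le_of_ne (not_lt.mp hlt) hne)) (π.apply_symm_apply z)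
  · subst hkz
    have hk' : π⁻¹ (π k) = k := π.symm_apply_apply k
    rw [hk'] at h
    exact absurd h (not_lt.mpr (Fin.le_def.mpr hk.le))

open Classical in
-- A local minimum is a descent followed by an ascent; the forced boundary letters replace the
-- neighbour missing at an end of the path.
theorem rise_ascent_eq {n : ℕ} (π : Equiv.Perm (Fin n)) (w : Fin n) :
    (1 - ascent π⁻¹ w) * ascent π⁻¹ (w + 1) = if CreatesKink π (π⁻¹ w) then 1 else 0 := by
  have hl : (ascent π⁻¹ w = 0) ↔ ∀ z : Fin n, z.val + 1 = w.val → π⁻¹ w < π⁻¹ z := by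
    rw [ascent, ite_eq_right_iff]
    simp only [one_ne_zero, imp_false, not_and, not_or, not_lt, paddedWord_succ]
    constructor
    · intro h z hz
      have h1 := (h (by omega)).2
      rw [← hz, paddedWord_succ] at h1
      refine lt_of_le_of_ne (Fin.le_def.mpr h1) fun he => ?_
      have := (π⁻¹).injective he
      subst this
      omega
    · intro h h0
      refine ⟨by omega, ?_⟩
      have h1 := h ⟨w - 1, by omega⟩ (by simp; omega)
      have h2 := paddedWord_succ π⁻¹ ⟨w - 1, by omega⟩
      rw [show ((⟨w - 1, by omega⟩ : Fin n) : ℕ) + 1 = w by simp; omega] at h2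
      rw [h2]
      exact (Fin.lt_def.mp h1).le
  have hr : (ascent π⁻¹ (w + 1) = 1) ↔ ∀ z : Fin n, w.val + 1 = z.val → π⁻¹ w < π⁻¹ z := by
    rw [ascent, ite_eq_left_iff]
    simp only [zero_ne_one, imp_false, not_not, paddedWord_succ]
    constructor
    · rintro ⟨-, h | h⟩ z hz
      · omega
      · rw [hz, paddedWord_succ] at h
        exact h
    · intro h
      refine ⟨by omega, ?_⟩
      by_cases hw : w.val + 1 = n
      · exact Or.inl hw
      · have h1 := h ⟨w + 1, by omega⟩ rfl
        have h2 := paddedWord_succ π⁻¹ ⟨w + 1, by omega⟩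
        exact Or.inr (by rw [h2]; exact h1)
  have hk : CreatesKink π (π⁻¹ w) ↔ ascent π⁻¹ w = 0 ∧ ascent π⁻¹ (w + 1) = 1 := by
    rw [createsKink_iff, hl, hr]
    exact ⟨fun h => ⟨fun z hz => h z (Or.inr hz), fun z hz => h z (Or.inl hz)⟩,
      fun h z hz => hz.elim (h.2 z) (h.1 z)⟩
  simp only [hk]
  rcases ascent_zero_or_one π⁻¹ w with h | h <;>
    rcases ascent_zero_or_one π⁻¹ (w + 1) with h' | h' <;> simp [h, h']

theorem valleyCount_inv {n : ℕ} (hn : n ≠ 0) (π : Equiv.Perm (Fin n)) :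
    valleyCount π⁻¹ = extraKinks π + 1 := by
  classical
  have h1 : valleyCount π⁻¹ = ∑ i : Fin n, if CreatesKink π i then (1 : ℤ) else 0 := by
    rw [valleyCount, riseCount,
      ← Fin.sum_univ_eq_sum_range (fun i => (1 - ascent π⁻¹ i) * ascent π⁻¹ (i + 1)),
      ← Equiv.sum_comp π⁻¹ fun i => if CreatesKink π i then (1 : ℤ) else 0]
    exact Finset.sum_congr rfl fun w _ => rise_ascent_eq π w
  obtain ⟨m, rfl⟩ := Nat.exists_eq_succ_of_ne_zero hn
  -- The first step always creates a kink, which accounts for the `+ 1`.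
  have h0 : CreatesKink π 0 := by
    intro z _
    simp [plusSites]
  have h2 : (extraKinks π : ℤ) =
      ∑ i : Fin (m + 1), if 0 < i.val ∧ CreatesKink π i then (1 : ℤ) else 0 := by
    rw [Finset.sum_boole, extraKinks]
  rw [h1, h2, Fin.sum_univ_succ, Fin.sum_univ_succ]
  simp [h0, add_comm]

theorem card_historySet {n : ℕ} (hn : n ≠ 0) (d : ℕ) :
    ((historySet n d).card : ℤ) = valleyNumber n (d + 1) := by
  rw [valleyNumber, ← Equiv.sum_comp (Equiv.inv (Equiv.Perm (Fin n))), historySet,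
    Finset.card_filter]
  push_cast
  refine Finset.sum_congr rfl fun π _ => ?_
  rw [Equiv.inv_apply, valleyCount_inv hn]
  congr 1
  simp

theorem valleyNumber_zero {n : ℕ} (hn : n ≠ 0) : valleyNumber n 0 = 0 := by
  refine Finset.sum_eq_zero fun σ _ => if_neg ?_
  have := valleyCount_inv hn σ⁻¹
  rw [inv_inv] at this
  omega

theorem card_historySet_succ_zero {n : ℕ} (hn : n ≠ 0) :
    (historySet (n + 1) 0).card = 2 * (historySet n 0).card := by
  have h := valleyNumber_succ hn 0
  have h1 := card_historySet (n := n + 1) (by omega) 0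
  have h2 := card_historySet hn 0
  push_cast at h1 h2
  rw [zero_add, valleyNumber_zero hn, ← h1, ← h2] at h
  zify
  linear_combination h

theorem card_historySet_succ_succ {n : ℕ} (hn : n ≠ 0) (d : ℕ) :
    ((historySet (n + 1) (d + 1)).card : ℤ) =
      (2 * d + 4) * (historySet n (d + 1)).card + (n - 2 * d - 1) * (historySet n d).card := by
  have h := valleyNumber_succ hn (d + 1)
  have h1 := card_historySet (n := n + 1) (by omega) (d + 1)
  have h2 := card_historySet hn (d + 1)
  have h3 := card_historySet hn d
  push_cast at h1 h2
  rw [← h1, ← h2, ← h3] at h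
  linear_combination h

theorem card_historySet_one (d : ℕ) : (historySet 1 d).card = if d = 0 then 1 else 0 := by
  have h : ∀ π : Equiv.Perm (Fin 1), extraKinks π = 0 := by
    intro π
    simp [extraKinks]
  simp only [historySet, h]
  split_ifs with hd
  · subst hd; simp
  · simp [Ne.symm hd]

/-! ### The growth equation for histories -/

theorem bcoeff_tVar (n d : ℕ) : bcoeff n d tVar = if n = 1 ∧ d = 0 then 1 else 0 := by
  rw [bcoeff, tVar, MvPowerSeries.coeff_X]
  congr 1
  simp [Finsupp.ext_iff]

theorem bcoeff_historyGF_add_tVar (n d : ℕ) :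
    bcoeff n d (historyGF + tVar) = if n = 0 then 0 else ((historySet n d).card : ℚ) := by
  have h : bcoeff n d historyGF = if 2 ≤ n then ((historySet n d).card : ℚ) else 0 := by
    have h0 : (Finsupp.single 0 n + Finsupp.single 1 d : Fin 2 →₀ ℕ) 0 = n := by simp
    have h1 : (Finsupp.single 0 n + Finsupp.single 1 d : Fin 2 →₀ ℕ) 1 = d := by simp
    change (if 2 ≤ (Finsupp.single 0 n + Finsupp.single 1 d : Fin 2 →₀ ℕ) 0 then
      ((historySet ((Finsupp.single 0 n + Finsupp.single 1 d : Fin 2 →₀ ℕ) 0)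
        ((Finsupp.single 0 n + Finsupp.single 1 d : Fin 2 →₀ ℕ) 1)).card : ℚ) else 0) = _
    rw [h0, h1]
  rw [map_add, h, bcoeff_tVar]
  rcases n with _ | _ | n
  · simp
  · simp [card_historySet_one]
  · simp

theorem historyGF_growth :
    historyGF + tVar = tVar + tVar * growthOp (historyGF + tVar) := by
  refine bivSeries_ext fun n d => ?_
  rw [map_add _ tVar (_ * _)]
  rcases n with _ | n
  · rw [bcoeff_zero_tVar_mul, bcoeff_historyGF_add_tVar, bcoeff_tVar]
    simp
  rw [bcoeff_succ_tVar_mul, bcoeff_tVar]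
  -- The insertion recurrence starts at length `1`; the coefficient of `t` itself comes from the
  -- inhomogeneous term.
  rcases Nat.eq_zero_or_pos n with rfl | hn
  · rcases d with _ | d
    · rw [bcoeff_growthOp_zero]
      simp [bcoeff_historyGF_add_tVar, card_historySet_one]
    · rw [bcoeff_growthOp_succ]
      simp [bcoeff_historyGF_add_tVar, card_historySet_one]
  · have hn' : n ≠ 0 := hn.ne'
    rcases d with _ | d
    · rw [bcoeff_growthOp_zero]
      simp only [bcoeff_historyGF_add_tVar]
      simp [hn', card_historySet_succ_zero hn']
    · rw [bcoeff_growthOp_succ]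
      simp only [bcoeff_historyGF_add_tVar]
      simpa [hn'] using congrArg (Int.cast : ℤ → ℚ) (card_historySet_succ_succ hn' d)

theorem theorem1 :
    HasFormalSum
      (fun j : ℕ =>
        4 * tVar ^ 2 * sqrtOneSub *
            (1 - (1 + 2 * (j : BivSeries)) * sqrtOneSub * tVar - tVar * (1 - vVar)) * vVar ^ j *
          ((1 + sqrtOneSub) ^ (1 + 2 * j) * (1 - 2 * (j : BivSeries) * tVar * sqrtOneSub) ^ 2 *
            (1 - 2 * ((j : BivSeries) + 1) * tVar * sqrtOneSub) ^ 2)⁻¹)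
      historyGF :=
  hasFormalSum_explicitTerm historyGF_growth
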